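/- Let $\mathcal J$ be a finite set of positive integers. For a sequence $s=(s_n)_{n\ge 0}$ with values in $\mathcal J$ put $\mu_s(x)=\sum_{n\ge 0}s_n\chi_{[n,n+1)}(x)$, $x\ge 0$, and $\tau_s u=-\frac1{\mu_s}(\mu_s u')'$. For $z\in\mathbb C$ let $\varphi_s(z,\cdot)$ and $\theta_s(z,\cdot)$ be the solutions of $\tau_s u=zu$ on $[0,\infty)$ (with $u$ and $\mu_s u'$ locally absolutely continuous on $[0,\infty)$ and the equation holding almost everywhere) such that $\varphi_s(z,0)=0$, $(\mu_s\varphi_s')(z,0)=1$, and $\theta_s(z,0)=1$, $(\mu_s\theta_s')(z,0)=0$. The Weyl–Titchmarsh function $m_s$ of $s$ is defined for $z\in\mathbb C\setminus\mathbb R$ by letting $m_s(z)$ be the unique complex number with $\theta_s(z,\cdot)+m_s(z)\varphi_s(z,\cdot)\in L^2((0,\infty);\mu_s\,dx)$. Let $\sqrt{\cdot}$ be the principal branch of the square root, so that $\operatorname{Re}\sqrt{-z}>0$ for $z\in\mathbb C\setminus[0,\infty)$. Let $s=(s_n)_{n\ge0}$ and $\tilde s=(\tilde s_n)_{n\ge0}$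 be sequences with values in $\mathcal J$, with Weyl–Titchmarsh functions $m=m_s$ and $\tilde m=m_{\tilde s}$, and let $k\ge 0$ be an integer. Then $$s_j=\tilde s_j\quad\text{for all } 0\le j\le k$$ if and only if for every $\alpha\in(-\pi,\pi)\setminus\{0\}$ one has $$|m(z)-\tilde m(z)|=o\!\left(\exp\{-2(k+1/2)\operatorname{Re}\sqrt{-z}\}\right)\quad\text{as } z\to\infty \text{ along the ray } \arg z=\alpha.$$ -/

import Mathlib

open MeasureTheory Set Filter Asymptotics

noncomputable section

namespace ImpedanceSL

/-- The weight `μ = ∑ₙ sₙ χ_{[n, n+1)}` on `[0, ∞)`. (Only the values at `x ≥ 0` are ever used.) -/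
def weight (s : ℕ → ℕ) (x : ℝ) : ℝ := (s ⌊x⌋₊ : ℝ)

/-- The measure `μ(x) dx` on the half-line `(0, ∞)`. -/
def weightMeasure (s : ℕ → ℕ) : Measure ℝ :=
  (volume.restrict (Ioi 0)).withDensity (fun x => ENNReal.ofReal (weight s x))

/-- `u` solves `τ u = z u` on the half-line, where `τ u = -(1/μ) (μ u')'`, and `q` is the
continuous representative of its quasi-derivative `μ u'`: both `u` and `q` are absolutely
continuous on every `[0, b]`, and almost everywhere on `(0, ∞)` one has `u' = q / μ` and
`q' = -z μ u`. -/
structure IsSolution (s : ℕ → ℕ) (z : ℂ) (u q : ℝ → ℂ) : Prop where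
  ac : ∀ b : ℝ, 0 < b → AbsolutelyContinuousOnInterval u 0 b
  ac_quasi : ∀ b : ℝ, 0 < b → AbsolutelyContinuousOnInterval q 0 b
  quasi_eq : ∀ᵐ x ∂(volume.restrict (Ioi (0 : ℝ))), HasDerivAt u (q x / (weight s x : ℂ)) x
  eqn : ∀ᵐ x ∂(volume.restrict (Ioi (0 : ℝ))), HasDerivAt q (-(z * (weight s x : ℂ) * u x)) x

/-- `φ` is the Dirichlet solution `φ(z, ·)`: `φ(0) = 0`, `(μ φ')(0) = 1`. -/
def IsDirichletSolution (s : ℕ → ℕ) (z : ℂ) (φ : ℝ → ℂ) : Prop :=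
  ∃ q : ℝ → ℂ, IsSolution s z φ q ∧ φ 0 = 0 ∧ q 0 = 1

/-- `θ` is the Neumann solution `θ(z, ·)`: `θ(0) = 1`, `(μ θ')(0) = 0`. -/
def IsNeumannSolution (s : ℕ → ℕ) (z : ℂ) (θ : ℝ → ℂ) : Prop :=
  ∃ q : ℝ → ℂ, IsSolution s z θ q ∧ θ 0 = 1 ∧ q 0 = 0

/-- `c` is a Weyl coefficient at `z`: the solution `ψ = θ(z, ·) + c φ(z, ·)` lies in
`L²((0, ∞); μ)`. (The solutions `θ(z, ·)` and `φ(z, ·)` are unique on `[0, ∞)`.) -/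
def IsWeylCoefficient (s : ℕ → ℕ) (z c : ℂ) : Prop :=
  ∃ θ φ : ℝ → ℂ, IsNeumannSolution s z θ ∧ IsDirichletSolution s z φ ∧
    MemLp (fun x => θ x + c * φ x) 2 (weightMeasure s)

/-- The half-line Weyl–Titchmarsh function `m`: for non-real `z`, the number `m(z)` such that
`θ(z, ·) + m(z) φ(z, ·)` lies in `L²((0, ∞); μ)`. -/
def weylM (s : ℕ → ℕ) (z : ℂ) : ℂ :=
  Classical.epsilon (fun c : ℂ => IsWeylCoefficient s z c)

end ImpedanceSL

end

/-!
On a cell `[n, n + 1]` the impedance is constant, so with `z = -κ²`, `Re κ > 0`, every solution of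
`τ u = z u` is a superposition of `exp (-κ x)` and `exp (κ x)` there, and continuity of `u` and
`μ u'` at the integers relates the amplitudes on adjacent cells. The ratios `rₙ` of the growing to
the decaying amplitude of a solution thus obey the Schur recursion
`rₙ = w (ρₙ + rₙ₊₁) / (1 + ρₙ rₙ₊₁)`, where `w = exp (-2κ)` and
`ρₙ = (sₙ - sₙ₊₁) / (sₙ + sₙ₊₁)` is the reflection coefficient at `n + 1`.

The flux `Re (u * conj (μ u' / κ))` is nondecreasing along the integers. A square integrable
solution has non-positive flux (`IsSolution.flux_nonpos`), which says `|rₙ| ≤ 1`. Conversely a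
sequence in the disc that solves the recursion exists by compactness (`exists_isSchurSequence`), and
the solution built from it decays exponentially (`IsSolution.memLp_of_isSchurSequence`). Hence the
Weyl–Titchmarsh function is `m = -κ s₀ (1 - r₀) / (1 + r₀)` (`exists_weylM_eq`).

The recursion gives `|rₙ| ≤ |w|`, and each step multiplies differences of Schur sequences with equal
parameter by a factor of exact order `|w|`. If the impedances agree up to index `k`, then
`|m - m̃| = O(|κ| |w| ^ (k + 1))` (`norm_weylM_sub_le`); if they first differ at `j ≤ k`, then
`|m - m̃|` is at least of order `|κ| |w| ^ j` (`exists_le_norm_weylM_sub`). Since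
`|w| = exp (-2 Re √(-z))`, the rate `|w| ^ (k + 1/2)` separates the two cases.
-/

noncomputable section

namespace ImpedanceSL

open ComplexConjugate

/-! ### Solutions for piecewise constant impedance -/

lemma weight_eq {s : ℕ → ℕ} {n : ℕ} {x : ℝ} (h1 : (n : ℝ) ≤ x) (h2 : x < n + 1) :
    weight s x = s n := by
  have : ⌊x⌋₊ = n := by
    rw [Nat.floor_eq_iff (le_trans (Nat.cast_nonneg n) h1)]
    exact ⟨h1, h2⟩
  simp [weight, this]

/-- If `σ² = -z`, then on a cell `[n, n + 1]` of constant impedance the component `u + q / (σ sₙ)`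
of a solution of `τ u = z u` solves `f' = σ f`. -/
lemma IsSolution.add_div_eq {s : ℕ → ℕ} {z : ℂ} {u q : ℝ → ℂ} (h : IsSolution s z u q) {n : ℕ}
    (hs : 0 < s n) {σ : ℂ} (hσ : σ ≠ 0) (hz : z = -σ ^ 2) {x : ℝ}
    (hx : x ∈ Icc (n : ℝ) (n + 1)) :
    u x + q x / (σ * s n) = (u n + q n / (σ * s n)) * Complex.exp (σ * (x - n)) := by
  have hs' : (s n : ℂ) ≠ 0 := by exact_mod_cast hs.ne'
  have hn : (0 : ℝ) ≤ n := Nat.cast_nonneg n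
  have hsub : uIcc (n : ℝ) (n + 1) ⊆ uIcc 0 ((n : ℝ) + 1) := by
    rw [uIcc_of_le (by linarith), uIcc_of_le (by linarith)]
    exact Icc_subset_Icc_left hn
  have hac : AbsolutelyContinuousOnInterval u n (n + 1) := (h.ac (n + 1) (by linarith)).mono hsub
  have hacq : AbsolutelyContinuousOnInterval q n (n + 1) :=
    (h.ac_quasi (n + 1) (by linarith)).mono hsub
  have hace : AbsolutelyContinuousOnInterval
      (fun x : ℝ => Complex.exp (-σ * (x - n))) n (n + 1) := by
    apply ContDiffOn.absolutelyContinuousOnInterval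
    apply ContDiff.contDiffOn
    have : ContDiff ℝ 1 (fun x : ℝ => (x : ℂ)) := Complex.ofRealCLM.contDiff
    fun_prop
  have hf := hace.smul (hac.add (hacq.const_smul (σ * s n)⁻¹))
  obtain ⟨C, hC⟩ := hf.const_of_ae_hasDerivAt_zero (by
    have h1 := (ae_restrict_iff' measurableSet_Ioi).1 h.quasi_eq
    have h2 := (ae_restrict_iff' measurableSet_Ioi).1 h.eqn
    have h3 : ∀ᵐ x : ℝ, x ≠ n := Measure.ae_ne volume _
    have h4 : ∀ᵐ x : ℝ, x ≠ n + 1 := Measure.ae_ne volume _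
    filter_upwards [h1, h2, h3, h4] with x h1 h2 h3 h4 hx
    rw [uIcc_of_le (by linarith)] at hx
    have hl : (n : ℝ) < x := lt_of_le_of_ne hx.1 (Ne.symm h3)
    have hr : x < n + 1 := lt_of_le_of_ne hx.2 h4
    have hw : weight s x = s n := weight_eq hl.le hr
    have h1 := h1 (show 0 < x by linarith)
    have h2 := h2 (show 0 < x by linarith)
    rw [hw] at h1 h2
    have he : HasDerivAt (fun x : ℝ => Complex.exp (-σ * (x - n)))
        (Complex.exp (-σ * (x - n)) * (-σ * 1)) x :=
      ((((hasDerivAt_id x).ofReal_comp).sub_const _).const_mul _).cexp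
    refine (he.smul (h1.add (h2.fun_const_smul (σ * (s n : ℂ))⁻¹))).congr_deriv ?_
    simp only [Pi.add_apply, smul_eq_mul, hz, Complex.ofReal_natCast]
    field_simp
    ring)
  have e1 := hC x (by rw [uIcc_of_le (by linarith)]; exact hx)
  have e2 := hC n (by simp)
  rw [← e2] at e1
  simp only [Pi.smul_apply', Pi.add_apply, smul_eq_mul, Complex.ofReal_natCast, sub_self, mul_zero,
    Complex.exp_zero, one_mul] at e1
  rw [div_eq_inv_mul, div_eq_inv_mul, ← e1, mul_right_comm, ← Complex.exp_add]
  simp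

/-- Piecewise `C¹` functions, glued continuously at the positive integers, are absolutely
continuous on bounded intervals and have the expected derivative almost everywhere. -/
lemma glue_floor {f f' : ℕ → ℝ → ℂ} (hf : ∀ n x, HasDerivAt (f n) (f' n x) x)
    (hf' : ∀ n, Continuous (f' n)) (hglue : ∀ n : ℕ, f n (n + 1) = f (n + 1) (n + 1)) :
    (∀ b : ℝ, 0 < b → AbsolutelyContinuousOnInterval (fun x => f ⌊x⌋₊ x) 0 b) ∧
      ∀ᵐ x ∂(volume.restrict (Ioi (0 : ℝ))),
        HasDerivAt (fun x => f ⌊x⌋₊ x) (f' ⌊x⌋₊ x) x := by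
  have hcell : ∀ n : ℕ, ∀ x : ℝ, x ∈ Ico (n : ℝ) (n + 1) → ⌊x⌋₊ = n := fun n x hx => by
    rw [Nat.floor_eq_iff (le_trans (Nat.cast_nonneg n) hx.1)]
    exact hx
  constructor
  · have hcell' : ∀ n : ℕ, EqOn (fun x => f ⌊x⌋₊ x) (f n) (Icc (n : ℝ) (n + 1)) := by
      intro n x hx
      rcases hx.2.lt_or_eq with h | h
      · simp [hcell n x ⟨hx.1, h⟩]
      · have : ⌊x⌋₊ = n + 1 := by
          rw [h]; exact_mod_cast Nat.floor_natCast (n + 1)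
        change f ⌊x⌋₊ x = f n x
        rw [this, h, hglue]
    have hcont : ∀ N : ℕ, ContinuousOn (fun x => f ⌊x⌋₊ x) (Icc (0 : ℝ) N) := by
      intro N
      induction N with
      | zero => simp
      | succ N ih =>
        have hN : (0 : ℝ) ≤ N := Nat.cast_nonneg N
        push_cast
        rw [← Icc_union_Icc_eq_Icc hN (by linarith : (N : ℝ) ≤ N + 1)]
        refine ih.union_of_isClosed ?_ isClosed_Icc isClosed_Icc
        have hc : Continuous (f N) :=
          continuous_iff_continuousAt.2 fun x => (hf N x).continuousAt
        exact hc.continuousOn.congr (hcell' N)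
    intro b hb
    have hcb : ContinuousOn (fun x => f ⌊x⌋₊ x) (Icc (0 : ℝ) b) :=
      (hcont (⌊b⌋₊ + 1)).mono (Icc_subset_Icc_right (by
        push_cast; exact (Nat.lt_floor_add_one b).le))
    have hbd : ∀ n : ℕ, ∃ C, ∀ x ∈ Icc (0 : ℝ) b, ‖f' n x‖ ≤ C := fun n =>
      isCompact_Icc.exists_bound_of_continuousOn (hf' n).continuousOn
    choose C hC using hbd
    have hC0 : ∀ n, 0 ≤ C n := fun n =>
      (norm_nonneg _).trans (hC n 0 ⟨le_rfl, hb.le⟩)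
    set K := ∑ n ∈ Finset.range (⌊b⌋₊ + 1), C n with hK
    have hK0 : 0 ≤ K := Finset.sum_nonneg fun n _ => hC0 n
    have hbound : ∀ x ∈ Icc (0 : ℝ) b, ‖f' ⌊x⌋₊ x‖ ≤ K := by
      intro x hx
      refine (hC _ x hx).trans ?_
      refine Finset.single_le_sum (f := C) (fun n _ => hC0 n) ?_
      rw [Finset.mem_range]
      exact Nat.lt_succ_of_le (Nat.floor_mono hx.2)
    have hright : ∀ x : ℝ, 0 ≤ x →
        HasDerivWithinAt (fun x => f ⌊x⌋₊ x) (f' ⌊x⌋₊ x) (Ici x) x := by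
      intro x hx
      refine (hf ⌊x⌋₊ x).hasDerivWithinAt.congr_of_eventuallyEq ?_ rfl
      filter_upwards [Ico_mem_nhdsGE (Nat.lt_floor_add_one x)] with y hy
      rw [hcell ⌊x⌋₊ y ⟨(Nat.floor_le hx).trans hy.1, hy.2⟩]
    have hle : ∀ x ∈ Icc (0 : ℝ) b, ∀ y ∈ Icc (0 : ℝ) b, x ≤ y →
        dist (f ⌊x⌋₊ x) (f ⌊y⌋₊ y) ≤ K * dist x y := by
      intro x hx y hy hxy
      have := norm_image_sub_le_of_norm_deriv_right_le_segment (f := fun x => f ⌊x⌋₊ x)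
        (f' := fun x => f' ⌊x⌋₊ x) (C := K) (a := x) (b := y)
        (hcb.mono (Icc_subset_Icc hx.1 hy.2)) (fun t ht => hright t (hx.1.trans ht.1))
        (fun t ht => hbound t ⟨hx.1.trans ht.1, ht.2.le.trans hy.2⟩) y ⟨hxy, le_rfl⟩
      rw [dist_comm, dist_comm x, dist_eq_norm, Real.dist_eq, abs_of_nonneg (by linarith)]
      exact this
    refine LipschitzOnWith.absolutelyContinuousOnInterval (K := ⟨K, hK0⟩) ?_
    rw [uIcc_of_le hb.le]
    refine LipschitzOnWith.of_dist_le_mul fun x hx y hy => ?_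
    rcases le_total x y with hxy | hxy
    · exact hle x hx y hy hxy
    · rw [dist_comm, dist_comm x]; exact hle y hy x hx hxy
  · rw [ae_restrict_iff' measurableSet_Ioi]
    filter_upwards [(countable_range (Nat.cast : ℕ → ℝ)).ae_notMem volume] with x hx h0
    have h0 : 0 < x := h0
    refine (hf ⌊x⌋₊ x).congr_of_eventuallyEq ?_
    have h1 : (⌊x⌋₊ : ℝ) < x :=
      lt_of_le_of_ne (Nat.floor_le h0.le) fun h => hx ⟨_, h⟩
    filter_upwards [Ioo_mem_nhds h1 (Nat.lt_floor_add_one x)] with y hy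
    rw [hcell ⌊x⌋₊ y ⟨hy.1.le, hy.2⟩]

/-- The values `(u(n), (μ u')(n))` at the integers of the solution of `τ u = -κ² u` with initial
data `(a, b)`. -/
def nodeValues (s : ℕ → ℕ) (κ a b : ℂ) : ℕ → ℂ × ℂ
  | 0 => (a, b)
  | n + 1 =>
    let p := nodeValues s κ a b n
    (Complex.cosh κ * p.1 + Complex.sinh κ / (κ * s n) * p.2,
      κ * s n * Complex.sinh κ * p.1 + Complex.cosh κ * p.2)

lemma exists_isSolution {s : ℕ → ℕ} (hs : ∀ n, 0 < s n) {κ : ℂ} (hκ : κ ≠ 0) (a b : ℂ) :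
    ∃ u q : ℝ → ℂ, IsSolution s (-κ ^ 2) u q ∧ u 0 = a ∧ q 0 = b := by
  set p := nodeValues s κ a b with hp
  have hs' : ∀ n, (s n : ℂ) ≠ 0 := fun n => by exact_mod_cast (hs n).ne'
  set f : ℕ → ℝ → ℂ := fun n x =>
    Complex.cosh (κ * (x - n)) * (p n).1 + Complex.sinh (κ * (x - n)) / (κ * s n) * (p n).2
    with hfdef
  set g : ℕ → ℝ → ℂ := fun n x =>
    κ * s n * Complex.sinh (κ * (x - n)) * (p n).1 + Complex.cosh (κ * (x - n)) * (p n).2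
    with hgdef
  have hlin : ∀ (n : ℕ) (x : ℂ), HasDerivAt (fun x : ℂ => κ * (x - n)) (κ * 1) x :=
    fun n x => ((hasDerivAt_id x).sub_const _).const_mul _
  have hf : ∀ n x, HasDerivAt (f n) (g n x / s n) x := by
    intro n x
    refine (((hlin n x).ccosh.mul_const (p n).1).add
      (((hlin n x).csinh.div_const (κ * s n)).mul_const (p n).2)).comp_ofReal.congr_deriv ?_
    have := hs' n
    simp only [hgdef]
    field_simp
  have hg : ∀ n x, HasDerivAt (g n) (-(-κ ^ 2 * s n * f n x)) x := by
    intro n x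
    refine ((((hlin n x).csinh.const_mul (κ * s n)).mul_const (p n).1).add
      ((hlin n x).ccosh.mul_const (p n).2)).comp_ofReal.congr_deriv ?_
    have := hs' n
    simp only [hfdef]
    field_simp
  have hfc : ∀ n, Continuous (f n) := fun n =>
    continuous_iff_continuousAt.2 fun x => (hf n x).continuousAt
  have hgc : ∀ n, Continuous (g n) := fun n =>
    continuous_iff_continuousAt.2 fun x => (hg n x).continuousAt
  have hF := glue_floor hf (fun n => (hgc n).div_const _) (fun n => by
    simp [hfdef, hp, nodeValues])
  have hG := glue_floor hg (fun n => by have := hfc n; fun_prop) (fun n => by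
    simp [hgdef, hp, nodeValues])
  refine ⟨fun x => f ⌊x⌋₊ x, fun x => g ⌊x⌋₊ x, ⟨hF.1, hG.1, ?_, ?_⟩, ?_, ?_⟩
  · filter_upwards [hF.2] with x hx
    simpa [weight] using hx
  · filter_upwards [hG.2] with x hx
    simpa [weight] using hx
  · simp [hfdef, hp, nodeValues]
  · simp [hgdef, hp, nodeValues]

lemma IsSolution.add_const_mul {s : ℕ → ℕ} {z : ℂ} {u q v p : ℝ → ℂ} (hu : IsSolution s z u q)
    (hv : IsSolution s z v p) (c : ℂ) :
    IsSolution s z (fun x => u x + c * v x) (fun x => q x + c * p x) where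
  ac b hb := (hu.ac b hb).add ((hv.ac b hb).const_smul c)
  ac_quasi b hb := (hu.ac_quasi b hb).add ((hv.ac_quasi b hb).const_smul c)
  quasi_eq := by
    filter_upwards [hu.quasi_eq, hv.quasi_eq] with x h1 h2
    refine (h1.add (h2.const_mul c)).congr_deriv ?_
    ring
  eqn := by
    filter_upwards [hu.eqn, hv.eqn] with x h1 h2
    refine (h1.add (h2.const_mul c)).congr_deriv ?_
    ring

/-! ### Wave amplitudes and flux -/

/-- The amplitude at `x = n` of the component `exp (-κ x)` of a solution with quasi-derivative `q`
on the cell `[n, n + 1]`, up to a factor `2`. -/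
def decayingPart (s : ℕ → ℕ) (κ : ℂ) (u q : ℝ → ℂ) (n : ℕ) : ℂ := u n - q n / (κ * s n)

/-- The amplitude at `x = n` of the component `exp (κ x)` of a solution with quasi-derivative `q`
on the cell `[n, n + 1]`, up to a factor `2`. -/
def growingPart (s : ℕ → ℕ) (κ : ℂ) (u q : ℝ → ℂ) (n : ℕ) : ℂ := u n + q n / (κ * s n)

/-- The energy flux of a solution. It involves only the continuous functions `u` and `q`, hence does
not jump at the interfaces. -/
def flux (κ : ℂ) (u q : ℝ → ℂ) (x : ℝ) : ℝ := (u x * conj (q x / κ)).re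

/-- The reflection coefficient of the interface at `n + 1`. -/
def reflection (s : ℕ → ℕ) (n : ℕ) : ℝ := ((s n : ℝ) - s (n + 1)) / (s n + s (n + 1))

section Solution

variable {s : ℕ → ℕ} {κ : ℂ} {u q : ℝ → ℂ}

lemma IsSolution.growing_eq (h : IsSolution s (-κ ^ 2) u q) (hκ : κ ≠ 0) {n : ℕ} (hs : 0 < s n)
    {x : ℝ} (hx : x ∈ Icc (n : ℝ) (n + 1)) :
    u x + q x / (κ * s n) = growingPart s κ u q n * Complex.exp (κ * (x - n)) :=
  h.add_div_eq hs hκ rfl hx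

lemma IsSolution.decaying_eq (h : IsSolution s (-κ ^ 2) u q) (hκ : κ ≠ 0) {n : ℕ} (hs : 0 < s n)
    {x : ℝ} (hx : x ∈ Icc (n : ℝ) (n + 1)) :
    u x - q x / (κ * s n) = decayingPart s κ u q n * Complex.exp (-(κ * (x - n))) := by
  have := h.add_div_eq hs (neg_ne_zero.2 hκ) (by ring) hx
  simpa only [neg_mul, div_neg, ← sub_eq_add_neg, decayingPart] using this

lemma norm_exp_mul_sub (κ : ℂ) (x : ℝ) (n : ℕ) :
    ‖Complex.exp (κ * (x - n))‖ = Real.exp (κ.re * (x - n)) := by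
  rw [Complex.norm_exp]; simp

lemma norm_exp_neg_mul_sub (κ : ℂ) (x : ℝ) (n : ℕ) :
    ‖Complex.exp (-(κ * (x - n)))‖ = Real.exp (-(κ.re * (x - n))) := by
  rw [Complex.norm_exp]; simp

lemma four_mul_re_mul_conj (U Q : ℂ) {t : ℝ} (ht : t ≠ 0) :
    4 * (U * conj Q).re = t * (‖U + Q / t‖ ^ 2 - ‖U - Q / t‖ ^ 2) := by
  rw [Complex.sq_norm, Complex.sq_norm, Complex.normSq_add, Complex.normSq_sub]
  have : (U * conj (Q / t)).re = (U * conj Q).re / t := by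
    simp [← mul_div_assoc]
  rw [this]
  field_simp
  ring

lemma IsSolution.flux_eq (h : IsSolution s (-κ ^ 2) u q) (hκ : κ ≠ 0) {n : ℕ} (hs : 0 < s n)
    {x : ℝ} (hx : x ∈ Icc (n : ℝ) (n + 1)) :
    4 * flux κ u q x = s n * (‖growingPart s κ u q n‖ ^ 2 * Real.exp (2 * κ.re * (x - n))
      - ‖decayingPart s κ u q n‖ ^ 2 * Real.exp (-(2 * κ.re * (x - n)))) := by
  have hs' : (s n : ℝ) ≠ 0 := by exact_mod_cast hs.ne'
  have e : q x / κ / ((s n : ℝ) : ℂ) = q x / (κ * s n) := by rw [div_div]; simp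
  rw [flux, four_mul_re_mul_conj _ _ hs', e, h.growing_eq hκ hs hx, h.decaying_eq hκ hs hx,
    norm_mul, norm_mul, norm_exp_mul_sub, norm_exp_neg_mul_sub, mul_pow, mul_pow,
    ← Real.exp_nat_mul, ← Real.exp_nat_mul]
  push_cast
  ring_nf

lemma IsSolution.flux_node (h : IsSolution s (-κ ^ 2) u q) (hκ : κ ≠ 0) {n : ℕ} (hs : 0 < s n) :
    4 * flux κ u q n = s n * (‖growingPart s κ u q n‖ ^ 2 - ‖decayingPart s κ u q n‖ ^ 2) := by
  simpa using h.flux_eq hκ hs (x := n) (by simp)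

lemma IsSolution.flux_succ (h : IsSolution s (-κ ^ 2) u q) (hκ : κ ≠ 0) {n : ℕ} (hs : 0 < s n) :
    4 * flux κ u q ((n + 1 : ℕ) : ℝ) = s n * (‖growingPart s κ u q n‖ ^ 2 * Real.exp (2 * κ.re)
      - ‖decayingPart s κ u q n‖ ^ 2 * Real.exp (-(2 * κ.re))) := by
  simpa using h.flux_eq hκ hs (x := ((n + 1 : ℕ) : ℝ)) (by simp)

lemma IsSolution.flux_monotone (h : IsSolution s (-κ ^ 2) u q) (hκ : 0 < κ.re)
    (hs : ∀ n, 0 < s n) : Monotone fun n : ℕ => flux κ u q n := by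
  have hκ0 : κ ≠ 0 := by rintro rfl; simp at hκ
  refine monotone_nat_of_le_succ fun n => ?_
  have h1 := h.flux_node hκ0 (hs n)
  have h2 := h.flux_succ hκ0 (hs n)
  have e1 : 1 ≤ Real.exp (2 * κ.re) := Real.one_le_exp (by linarith)
  have e2 : Real.exp (-(2 * κ.re)) ≤ 1 := Real.exp_le_one_iff.2 (by linarith)
  have : (s n : ℝ) * (‖growingPart s κ u q n‖ ^ 2 - ‖decayingPart s κ u q n‖ ^ 2) ≤
      s n * (‖growingPart s κ u q n‖ ^ 2 * Real.exp (2 * κ.re)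
      - ‖decayingPart s κ u q n‖ ^ 2 * Real.exp (-(2 * κ.re))) := by
    gcongr
    · exact le_mul_of_one_le_right (by positivity) e1
    · exact mul_le_of_le_one_right (by positivity) e2
  linarith

lemma restrict_le_weightMeasure (hs : ∀ n, 0 < s n) :
    volume.restrict (Ioi (0 : ℝ)) ≤ weightMeasure s := by
  conv_lhs => rw [← withDensity_one (μ := volume.restrict (Ioi (0 : ℝ)))]
  refine withDensity_mono (ae_of_all _ fun x => ?_)
  rw [Pi.one_apply, ENNReal.one_le_ofReal]
  rw [weight]
  exact_mod_cast hs _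

lemma weightMeasure_le_smul_restrict {M : ℕ} (hM : ∀ n, s n ≤ M) :
    weightMeasure s ≤ (M : ENNReal) • volume.restrict (Ioi (0 : ℝ)) := by
  rw [← withDensity_const]
  refine withDensity_mono (ae_of_all _ fun x => ?_)
  refine ENNReal.ofReal_le_of_le_toReal ?_
  simpa [weight] using hM _

/-- A square integrable solution has non-positive flux at every integer: otherwise the flux stays above a
positive constant from some integer on, which keeps `|u|` away from `0` on the right half of all
later cells. -/
lemma IsSolution.flux_nonpos (h : IsSolution s (-κ ^ 2) u q) (hκ : 0 < κ.re)
    (hs : ∀ n, 0 < s n) {M : ℕ} (hM : ∀ n, s n ≤ M) (hL : MemLp u 2 (weightMeasure s)) (N : ℕ) :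
    flux κ u q N ≤ 0 := by
  have hκ0 : κ ≠ 0 := by rintro rfl; simp at hκ
  by_contra! hpos
  set E := flux κ u q N with hE
  have hM0 : (0 : ℝ) < M := by exact_mod_cast (hs 0).trans_le (hM 0)
  set ε := Real.sqrt (4 * E / M) * (Real.exp (κ.re / 2) - 1) / 2 with hε
  have hε0 : 0 < ε := by
    have : 0 < Real.exp (κ.re / 2) - 1 := by
      rw [sub_pos]; exact Real.one_lt_exp_iff.2 (by linarith)
    have : 0 < Real.sqrt (4 * E / M) := Real.sqrt_pos.2 (by positivity)
    positivity
  have hlow : ∀ n : ℕ, N ≤ n → ∀ x ∈ Ico ((n : ℝ) + 1 / 2) (n + 1), ε ≤ ‖u x‖ := by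
    intro n hn x hx
    have hx' : x ∈ Icc (n : ℝ) (n + 1) := ⟨by linarith [hx.1], hx.2.le⟩
    have hsn : (0 : ℝ) < s n := by exact_mod_cast hs n
    have hsM : (s n : ℝ) ≤ M := by exact_mod_cast hM n
    have hEn : E ≤ flux κ u q n := h.flux_monotone hκ hs hn
    have hfl := h.flux_node hκ0 (hs n)
    set g := growingPart s κ u q n with hg
    set d := decayingPart s κ u q n with hd
    have hdg : ‖d‖ ^ 2 ≤ ‖g‖ ^ 2 := by
      by_contra! hc
      have := mul_neg_of_pos_of_neg hsn (sub_neg.2 hc)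
      linarith
    have hdg' : ‖d‖ ≤ ‖g‖ := (sq_le_sq₀ (norm_nonneg _) (norm_nonneg _)).1 hdg
    have hg2 : 4 * E / M ≤ ‖g‖ ^ 2 := by
      rw [div_le_iff₀ hM0]
      have : (s n : ℝ) * (‖g‖ ^ 2 - ‖d‖ ^ 2) ≤ M * ‖g‖ ^ 2 := by
        have := sq_nonneg ‖d‖
        apply mul_le_mul hsM (by linarith) (by linarith) hM0.le
      linarith
    have hg1 : Real.sqrt (4 * E / M) ≤ ‖g‖ := Real.sqrt_le_iff.2 ⟨norm_nonneg _, hg2⟩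
    have h2u : g * Complex.exp (κ * (x - n)) + d * Complex.exp (-(κ * (x - n))) = 2 * u x := by
      rw [← h.growing_eq hκ0 (hs n) hx', ← h.decaying_eq hκ0 (hs n) hx']; ring
    have hn1 : ‖g‖ * Real.exp (κ.re * (x - n)) - ‖d‖ * Real.exp (-(κ.re * (x - n)))
        ≤ 2 * ‖u x‖ := by
      have := norm_sub_le_norm_add (g * Complex.exp (κ * (x - n)))
        (d * Complex.exp (-(κ * (x - n))))
      rw [h2u, norm_mul, norm_mul, norm_mul, norm_exp_mul_sub, norm_exp_neg_mul_sub] at this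
      simpa using this
    have e1 : Real.exp (κ.re / 2) ≤ Real.exp (κ.re * (x - n)) := by
      apply Real.exp_le_exp.2
      nlinarith [hx.1]
    have e2 : Real.exp (-(κ.re * (x - n))) ≤ 1 := by
      apply Real.exp_le_one_iff.2
      nlinarith [hx'.1]
    have e3 : ‖d‖ * Real.exp (-(κ.re * (x - n))) ≤ ‖g‖ :=
      (mul_le_of_le_one_right (norm_nonneg _) e2).trans hdg'
    have e4 : ‖g‖ * Real.exp (κ.re / 2) ≤ ‖g‖ * Real.exp (κ.re * (x - n)) := by gcongr
    have e5 : Real.sqrt (4 * E / M) * (Real.exp (κ.re / 2) - 1) ≤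
        ‖g‖ * (Real.exp (κ.re / 2) - 1) := by
      apply mul_le_mul_of_nonneg_right hg1
      rw [sub_nonneg]; exact Real.one_le_exp (by linarith)
    rw [hε]
    linarith
  have hfin : (volume.restrict (Ioi (0 : ℝ))) {x | ε ≤ ‖u x‖} < ⊤ :=
    (hL.mono_measure (restrict_le_weightMeasure hs)).meas_ge_lt_top (ε := ⟨ε, hε0.le⟩)
      (by simp) (by simp) fun h0 => hε0.ne' (congrArg NNReal.toReal h0)
  set S : ℕ → Set ℝ := fun n => Ico (((N + n : ℕ) : ℝ) + 1 / 2) (((N + n : ℕ) : ℝ) + 1) with hS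
  have hdisj : Pairwise (Function.onFun Disjoint S) := by
    have key : ∀ m n : ℕ, m < n → Disjoint (S m) (S n) := by
      intro m n hmn
      rw [Set.disjoint_left]
      intro x hx hx'
      have : ((N + m : ℕ) : ℝ) + 1 ≤ ((N + n : ℕ) : ℝ) := by exact_mod_cast (by omega)
      linarith [hx.2, hx'.1]
    intro m n hmn
    rcases lt_or_gt_of_ne hmn with h | h
    · exact key m n h
    · exact (key n m h).symm
  have hsub : (⋃ n, S n) ⊆ {x | ε ≤ ‖u x‖} ∩ Ioi 0 := by
    refine iUnion_subset fun n x hx => ⟨hlow (N + n) (by omega) x hx, ?_⟩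
    have : (0 : ℝ) ≤ ((N + n : ℕ) : ℝ) := Nat.cast_nonneg _
    have := hx.1
    rw [mem_Ioi]; linarith
  have htop : volume (⋃ n, S n) = ⊤ := by
    rw [measure_iUnion hdisj fun n => measurableSet_Ico]
    have : ∀ n, volume (S n) = ENNReal.ofReal (1 / 2) := fun n => by
      rw [hS, Real.volume_Ico]; congr 1; ring
    simp_rw [this]
    exact ENNReal.tsum_const_eq_top_of_ne_zero (by simp)
  have : volume (⋃ n, S n) < ⊤ :=
    ((measure_mono hsub).trans (Measure.le_restrict_apply _ _)).trans_lt hfin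
  exact this.ne htop

end Solution

/-! ### Schur sequences and the Weyl–Titchmarsh function -/

/-- Sequences in the closed unit disc obeying the Schur recursion
`rₙ = w (ρₙ + rₙ₊₁) / (1 + ρₙ rₙ₊₁)` with Schur parameters `ρ`, written without division. -/
structure IsSchurSequence (ρ : ℕ → ℝ) (w : ℂ) (r : ℕ → ℂ) : Prop where
  norm_le_one : ∀ n, ‖r n‖ ≤ 1
  step : ∀ n, r n * (1 + ρ n * r (n + 1)) = w * (ρ n + r (n + 1))

lemma reflection_mem (s : ℕ → ℕ) (hs : ∀ n, 0 < s n) (n : ℕ) :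
    |reflection s n| < 1 := by
  have h1 : (0 : ℝ) < s n := by exact_mod_cast hs n
  have h2 : (0 : ℝ) < s (n + 1) := by exact_mod_cast hs (n + 1)
  rw [reflection, abs_div, abs_of_pos (by linarith : (0 : ℝ) < s n + s (n + 1)),
    div_lt_one (by linarith), abs_lt]
  constructor <;> linarith

section Disc

variable {ρ : ℝ} {r : ℂ}

lemma one_add_mul_ne_zero (hρ : |ρ| < 1) (hr : ‖r‖ ≤ 1) : (1 : ℂ) + ρ * r ≠ 0 := by
  intro h
  have h1 : (ρ : ℂ) * r = -1 := by linear_combination h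
  have h2 : |ρ| * ‖r‖ = 1 := by
    have := congrArg norm h1
    simpa using this
  have : |ρ| * ‖r‖ ≤ |ρ| := mul_le_of_le_one_right (abs_nonneg _) hr
  linarith

/-- The disc automorphism `r ↦ (ρ + r) / (1 + ρ r)` preserves the closed disc. -/
lemma norm_add_le_norm_one_add_mul (hρ : |ρ| < 1) (hr : ‖r‖ ≤ 1) :
    ‖(ρ : ℂ) + r‖ ≤ ‖1 + (ρ : ℂ) * r‖ := by
  rw [← sq_le_sq₀ (norm_nonneg _) (norm_nonneg _), Complex.sq_norm, Complex.sq_norm]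
  have h1 : Complex.normSq r ≤ 1 := by
    rw [Complex.normSq_eq_norm_sq]
    exact pow_le_one₀ (norm_nonneg _) hr
  have h2 : ρ ^ 2 ≤ 1 := by
    rw [← sq_abs]; exact pow_le_one₀ (abs_nonneg _) hρ.le
  rw [Complex.normSq_apply] at h1
  simp only [Complex.normSq_apply, Complex.add_re, Complex.add_im, Complex.mul_re, Complex.mul_im,
    Complex.ofReal_re, Complex.ofReal_im, Complex.one_re, Complex.one_im]
  nlinarith [mul_nonneg (sub_nonneg.2 h1) (sub_nonneg.2 h2)]

end Disc

section Schur

variable {ρ : ℕ → ℝ} {w : ℂ} {r : ℕ → ℂ}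

lemma IsSchurSequence.norm_le (h : IsSchurSequence ρ w r) (hρ : ∀ n, |ρ n| < 1) (n : ℕ) :
    ‖r n‖ ≤ ‖w‖ := by
  have h1 := norm_add_le_norm_one_add_mul (hρ n) (h.norm_le_one (n + 1))
  have h2 : 0 < ‖1 + (ρ n : ℂ) * r (n + 1)‖ :=
    norm_pos_iff.2 (one_add_mul_ne_zero (hρ n) (h.norm_le_one (n + 1)))
  have h3 := congrArg norm (h.step n)
  rw [norm_mul, norm_mul] at h3
  refine le_of_mul_le_mul_right ?_ h2
  rw [h3]
  gcongr

lemma exists_truncated_schurSequence (hw : ‖w‖ ≤ 1) (N : ℕ) :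
    ∀ ρ : ℕ → ℝ, (∀ n, |ρ n| < 1) → ∃ r : ℕ → ℂ, (∀ n, ‖r n‖ ≤ 1) ∧
      ∀ n < N, r n * (1 + ρ n * r (n + 1)) = w * (ρ n + r (n + 1)) := by
  induction N with
  | zero => exact fun ρ _ => ⟨fun _ => 0, by simp, by simp⟩
  | succ N ih =>
    intro ρ hρ
    obtain ⟨r, hr, hstep⟩ := ih (fun n => ρ (n + 1)) fun n => hρ (n + 1)
    have hne := one_add_mul_ne_zero (hρ 0) (hr 0)
    refine ⟨fun n => Nat.casesOn n (w * (ρ 0 + r 0) / (1 + ρ 0 * r 0)) r, ?_, ?_⟩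
    · rintro (_ | n)
      · change ‖w * (ρ 0 + r 0) / (1 + ρ 0 * r 0)‖ ≤ 1
        rw [norm_div, norm_mul]
        refine div_le_one_of_le₀ ?_ (norm_nonneg _)
        exact (mul_le_of_le_one_left (norm_nonneg _) hw).trans
          (norm_add_le_norm_one_add_mul (hρ 0) (hr 0))
      · exact hr n
    · rintro (_ | n) hn
      · exact div_mul_cancel₀ _ hne
      · exact hstep n (by omega)

/-- Finite stretches of the recursion are solved backwards from `0`; compactness of the product of
closed discs yields an infinite solution. -/
lemma exists_isSchurSequence (hρ : ∀ n, |ρ n| < 1) (hw : ‖w‖ ≤ 1) :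
    ∃ r, IsSchurSequence ρ w r := by
  set K : Set (ℕ → ℂ) := Set.pi univ fun _ => Metric.closedBall 0 1 with hK
  have hKc : IsCompact K := isCompact_univ_pi fun _ => isCompact_closedBall 0 1
  set t : ℕ → Set (ℕ → ℂ) := fun N =>
    K ∩ {r | ∀ n < N, r n * (1 + ρ n * r (n + 1)) = w * (ρ n + r (n + 1))} with ht
  have hcl : ∀ N, IsClosed (t N) := by
    intro N
    refine hKc.isClosed.inter ?_
    simp only [ofPred_forall]
    refine isClosed_iInter fun n => isClosed_iInter fun _ => isClosed_eq ?_ ?_ <;> fun_prop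
  obtain ⟨r, hr⟩ := IsCompact.nonempty_iInter_of_sequence_nonempty_isCompact_isClosed t
    (fun N r hr => ⟨hr.1, fun n hn => hr.2 n (by omega)⟩)
    (fun N => by
      obtain ⟨r, h1, h2⟩ := exists_truncated_schurSequence hw N ρ hρ
      exact ⟨r, fun n _ => by simpa using h1 n, h2⟩)
    (hKc.of_isClosed_subset (hcl 0) inter_subset_left) hcl
  rw [mem_iInter] at hr
  refine ⟨r, fun n => by simpa using (hr 0).1 n (mem_univ _), fun n => (hr (n + 1)).2 n (by omega)⟩

end Schur

section Weyl

variable {s : ℕ → ℕ} {κ : ℂ} {u q : ℝ → ℂ}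

/-- The transmission conditions at `n + 1`, on the level of the wave amplitudes: `U` and `Q` stand
for `u(n + 1)` and `q(n + 1) / κ`. -/
lemma IsSolution.exists_interface (h : IsSolution s (-κ ^ 2) u q) (hκ : κ ≠ 0)
    (hs : ∀ n, 0 < s n) (n : ℕ) :
    ∃ U Q : ℂ, growingPart s κ u q n * Complex.exp κ = U + Q / s n ∧
      decayingPart s κ u q n * Complex.exp (-κ) = U - Q / s n ∧
      growingPart s κ u q (n + 1) = U + Q / s (n + 1) ∧
      decayingPart s κ u q (n + 1) = U - Q / s (n + 1) := by
  have hx : ((n + 1 : ℕ) : ℝ) ∈ Icc (n : ℝ) (n + 1) := by simp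
  have h1 := h.growing_eq hκ (hs n) hx
  have h2 := h.decaying_eq hκ (hs n) hx
  have e : κ * (((n + 1 : ℕ) : ℝ) - (n : ℂ)) = κ := by push_cast; ring
  rw [e] at h1 h2
  refine ⟨u (n + 1 : ℕ), q (n + 1 : ℕ) / κ, ?_, ?_, ?_, ?_⟩
  · rw [← h1, div_div]
  · rw [← h2, div_div]
  · rw [growingPart, div_div]
  · rw [decayingPart, div_div]

lemma coe_reflection (s : ℕ → ℕ) (n : ℕ) :
    (reflection s n : ℂ) = ((s n : ℂ) - s (n + 1)) / (s n + s (n + 1)) := by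
  simp [reflection]

lemma norm_exp_neg_two_mul (κ : ℂ) : ‖Complex.exp (-2 * κ)‖ = Real.exp (-(2 * κ.re)) := by
  rw [Complex.norm_exp]; simp

lemma norm_exp_neg_two_mul_lt_one (hκ : 0 < κ.re) : ‖Complex.exp (-2 * κ)‖ < 1 := by
  rw [norm_exp_neg_two_mul, Real.exp_lt_one_iff]; linarith

/-- A square integrable solution has non-positive flux, so that the ratios of its growing to its
decaying amplitudes lie in the unit disc; the transmission conditions are then the Schur
recursion. -/
lemma IsSolution.exists_isSchurSequence (h : IsSolution s (-κ ^ 2) u q) (hκ : 0 < κ.re)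
    (hs : ∀ n, 0 < s n) (hflux : ∀ n : ℕ, flux κ u q n ≤ 0) (h0 : u 0 = 1) :
    ∃ r, IsSchurSequence (reflection s) (Complex.exp (-2 * κ)) r ∧
      q 0 = -(κ * s 0 * ((1 - r 0) / (1 + r 0))) := by
  have hκ0 : κ ≠ 0 := by rintro rfl; simp at hκ
  have hsc : ∀ n, (s n : ℂ) ≠ 0 := fun n => by exact_mod_cast (hs n).ne'
  have hsum : ∀ n, (s n : ℂ) + s (n + 1) ≠ 0 := fun n => by
    exact_mod_cast (Nat.add_pos_left (hs n) _).ne'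
  have hgd : ∀ n, ‖growingPart s κ u q n‖ ≤ ‖decayingPart s κ u q n‖ := by
    intro n
    have h1 := h.flux_node hκ0 (hs n)
    have h2 := hflux n
    have h3 : (0 : ℝ) < s n := by exact_mod_cast hs n
    rw [← sq_le_sq₀ (norm_nonneg _) (norm_nonneg _)]
    by_contra! hc
    have := mul_pos h3 (sub_pos.2 hc)
    linarith
  -- A vanishing amplitude would make the whole solution vanish.
  have hd : ∀ n, decayingPart s κ u q n ≠ 0 := by
    intro n
    induction n with
    | zero =>
      intro hz
      have hg : growingPart s κ u q 0 = 0 := by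
        have := hgd 0
        rw [hz, norm_zero] at this
        exact norm_le_zero_iff.1 this
      have : growingPart s κ u q 0 + decayingPart s κ u q 0 = 2 := by
        simp only [growingPart, decayingPart, Nat.cast_zero, h0]; ring
      rw [hz, hg] at this
      norm_num at this
    | succ n ih =>
      intro hz
      have hg : growingPart s κ u q (n + 1) = 0 := by
        have := hgd (n + 1)
        rw [hz, norm_zero] at this
        exact norm_le_zero_iff.1 this
      obtain ⟨U, Q, -, e2, e3, e4⟩ := h.exists_interface hκ0 hs n
      have hU : U = 0 := by linear_combination (-1 / 2 : ℂ) * (e3 + e4) + (hz + hg) / 2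
      have hQ : Q / s (n + 1) = 0 := by linear_combination -e3 + hg - hU
      have hQ : Q = 0 := by simpa [hsc] using hQ
      rw [hU, hQ] at e2
      simp only [zero_div, sub_zero, mul_eq_zero, Complex.exp_ne_zero, or_false] at e2
      exact ih e2
  refine ⟨fun n => growingPart s κ u q n / decayingPart s κ u q n,
    ⟨fun n => ?_, fun n => ?_⟩, ?_⟩
  · rw [norm_div]
    exact div_le_one_of_le₀ (hgd n) (norm_nonneg _)
  · obtain ⟨U, Q, e1, e2, e3, e4⟩ := h.exists_interface hκ0 hs n
    have hd0 := hd n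
    have hd1 := hd (n + 1)
    have hw : Complex.exp (-(2 * κ)) = Complex.exp (-κ) * Complex.exp (-κ) := by
      rw [← Complex.exp_add]; ring_nf
    have hee : Complex.exp κ * Complex.exp (-κ) = 1 := by
      rw [← Complex.exp_add]; simp
    have f1 : (decayingPart s κ u q (n + 1) + reflection s n * growingPart s κ u q (n + 1)) *
        (s n + s (n + 1)) = 2 * s n * (decayingPart s κ u q n * Complex.exp (-κ)) := by
      rw [e2, e3, e4, coe_reflection]
      have := hsc n
      have := hsc (n + 1)
      have := hsum n
      field_simp
      ring
    have f2 : (reflection s n * decayingPart s κ u q (n + 1) + growingPart s κ u q (n + 1)) *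
        (s n + s (n + 1)) = 2 * s n * (growingPart s κ u q n * Complex.exp κ) := by
      rw [e1, e3, e4, coe_reflection]
      have := hsc n
      have := hsc (n + 1)
      have := hsum n
      field_simp
      ring
    field_simp
    refine mul_right_cancel₀ (hsum n) ?_
    rw [mul_assoc, f1, hw]
    linear_combination (-(decayingPart s κ u q n * Complex.exp (-κ) * Complex.exp (-κ))) * f2 -
      2 * s n * decayingPart s κ u q n * growingPart s κ u q n * Complex.exp (-κ) * hee
  · have hd0 := hd 0
    have e : growingPart s κ u q 0 + decayingPart s κ u q 0 = 2 := by
      simp only [growingPart, decayingPart, Nat.cast_zero, h0]; ring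
    have e' : growingPart s κ u q 0 - decayingPart s κ u q 0 = 2 * (q 0 / (κ * s 0)) := by
      simp only [growingPart, decayingPart, Nat.cast_zero]; ring
    have hne : decayingPart s κ u q 0 + growingPart s κ u q 0 ≠ 0 := by
      rw [add_comm, e]; norm_num
    have : q 0 = κ * s 0 * ((growingPart s κ u q 0 - decayingPart s κ u q 0) / 2) := by
      rw [e']
      have := hsc 0
      field_simp
    rw [this]
    have e2 : (1 - growingPart s κ u q 0 / decayingPart s κ u q 0) /
        (1 + growingPart s κ u q 0 / decayingPart s κ u q 0) =
        -((growingPart s κ u q 0 - decayingPart s κ u q 0) / 2) := by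
      rw [div_eq_iff (by rw [one_add_div hd0]; exact div_ne_zero hne hd0)]
      field_simp
      linear_combination (growingPart s κ u q 0 - decayingPart s κ u q 0) * e
    rw [e2]; ring

/-- A solution whose initial data come from a Schur sequence is a pure reflected wave on every cell:
the ratio of its amplitudes on the `n`-th cell is `rₙ`. -/
lemma IsSolution.growingPart_eq (h : IsSolution s (-κ ^ 2) u q) (hκ : κ ≠ 0)
    (hs : ∀ n, 0 < s n) {r : ℕ → ℂ}
    (hr : IsSchurSequence (reflection s) (Complex.exp (-2 * κ)) r)
    (h0 : growingPart s κ u q 0 = r 0 * decayingPart s κ u q 0) (n : ℕ) :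
    growingPart s κ u q n = r n * decayingPart s κ u q n := by
  induction n with
  | zero => exact h0
  | succ n ih =>
    obtain ⟨U, Q, e1, e2, e3, e4⟩ := h.exists_interface hκ hs n
    have hsc : ∀ n, (s n : ℂ) ≠ 0 := fun n => by exact_mod_cast (hs n).ne'
    have hsum : (s n : ℂ) + s (n + 1) ≠ 0 := by
      exact_mod_cast (Nat.add_pos_left (hs n) _).ne'
    have hw : Complex.exp κ = Complex.exp (2 * κ) * Complex.exp (-κ) := by
      rw [← Complex.exp_add]; ring_nf
    have hee : Complex.exp (2 * κ) * Complex.exp (-2 * κ) = 1 := by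
      rw [← Complex.exp_add]; simp
    have hstep := hr.step n
    have key : (1 + reflection s n * r (n + 1)) * (U + Q / s n) =
        (reflection s n + r (n + 1)) * (U - Q / s n) := by
      rw [← e1, ← e2, ih, hw]
      linear_combination (decayingPart s κ u q n * Complex.exp (2 * κ) * Complex.exp (-κ)) * hstep
        + (decayingPart s κ u q n * Complex.exp (-κ) * (reflection s n + r (n + 1))) * hee
    rw [e3, e4]
    rw [coe_reflection] at key
    have := hsc n
    have := hsc (n + 1)
    field_simp at key ⊢
    have h2 : (2 : ℂ) * s n ≠ 0 := by simp [hsc]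
    refine mul_left_cancel₀ h2 ?_
    linear_combination key

/-- The flux of a pure reflected wave contracts by `|w| = exp (-2 Re κ)` on every cell, so the wave
decays exponentially. -/
lemma IsSolution.memLp_of_isSchurSequence (h : IsSolution s (-κ ^ 2) u q) (hκ : 0 < κ.re)
    (hs : ∀ n, 0 < s n) {M : ℕ} (hM : ∀ n, s n ≤ M) {r : ℕ → ℂ}
    (hr : IsSchurSequence (reflection s) (Complex.exp (-2 * κ)) r)
    (h0 : growingPart s κ u q 0 = r 0 * decayingPart s κ u q 0) :
    MemLp u 2 (weightMeasure s) := by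
  have hκ0 : κ ≠ 0 := by rintro rfl; simp at hκ
  have hg := h.growingPart_eq hκ0 hs hr h0
  set W := Real.exp (-(2 * κ.re)) with hW
  have hW0 : 0 < W := Real.exp_pos _
  have hW1 : W < 1 := Real.exp_lt_one_iff.2 (by linarith)
  have hrW : ∀ n, ‖r n‖ ≤ W := fun n => by
    rw [hW, ← norm_exp_neg_two_mul]
    exact hr.norm_le (reflection_mem s hs) n
  have hWinv : W * Real.exp (2 * κ.re) = 1 := by
    rw [hW, ← Real.exp_add]; simp
  have hE : ∀ n : ℕ, -(4 * flux κ u q n) = s n * ‖decayingPart s κ u q n‖ ^ 2 * (1 - ‖r n‖ ^ 2) :=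
    fun n => by rw [h.flux_node hκ0 (hs n), hg n, norm_mul]; ring
  have hcontr : ∀ n : ℕ, -(4 * flux κ u q ((n + 1 : ℕ) : ℝ)) ≤ W * -(4 * flux κ u q n) := by
    intro n
    rw [hE n, h.flux_succ hκ0 (hs n), hg n, norm_mul]
    have hX : 0 ≤ (s n : ℝ) * ‖decayingPart s κ u q n‖ ^ 2 := by positivity
    have hY : W ≤ Real.exp (2 * κ.re) := by
      rw [hW]; exact Real.exp_le_exp.2 (by linarith)
    have hZ : 0 ≤ (Real.exp (2 * κ.re) - W) * ‖r n‖ ^ 2 :=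
      mul_nonneg (sub_nonneg.2 hY) (by positivity)
    rw [← hW]
    nlinarith [mul_nonneg hX hZ]
  have hgeom : ∀ n : ℕ, -(4 * flux κ u q n) ≤ W ^ n * -(4 * flux κ u q (0 : ℕ)) := by
    intro n
    induction n with
    | zero => simp
    | succ n ih =>
      refine (hcontr n).trans ?_
      rw [pow_succ', mul_assoc]
      gcongr
  set C := -(4 * flux κ u q (0 : ℕ)) / (1 - W ^ 2) with hC
  have h1W : 0 < 1 - W ^ 2 := by
    have := pow_lt_one₀ hW0.le hW1 two_ne_zero
    linarith
  have hd : ∀ n : ℕ, ‖decayingPart s κ u q n‖ ^ 2 ≤ C * W ^ n := by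
    intro n
    rw [hC, div_mul_eq_mul_div, le_div_iff₀ h1W, mul_comm _ (W ^ n)]
    refine le_trans ?_ (hgeom n)
    rw [hE n]
    have h1 : 1 - W ^ 2 ≤ 1 - ‖r n‖ ^ 2 := by
      have := pow_le_pow_left₀ (norm_nonneg _) (hrW n) 2
      linarith
    have h2 : (1 : ℝ) ≤ s n := by exact_mod_cast hs n
    have h3 : ‖decayingPart s κ u q n‖ ^ 2 ≤ s n * ‖decayingPart s κ u q n‖ ^ 2 :=
      le_mul_of_one_le_left (by positivity) h2
    gcongr
  have hbound : ∀ x : ℝ, 0 ≤ x → ‖u x‖ ^ 2 ≤ C * (W ^ (-1 : ℤ) * Real.exp (-(2 * κ.re) * x)) := by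
    intro x hx
    set n := ⌊x⌋₊ with hn
    have hx1 : (n : ℝ) ≤ x := Nat.floor_le hx
    have hx2 : x < n + 1 := Nat.lt_floor_add_one x
    have hx' : x ∈ Icc (n : ℝ) (n + 1) := ⟨hx1, hx2.le⟩
    have h2u : growingPart s κ u q n * Complex.exp (κ * (x - n)) +
        decayingPart s κ u q n * Complex.exp (-(κ * (x - n))) = 2 * u x := by
      rw [← h.growing_eq hκ0 (hs n) hx', ← h.decaying_eq hκ0 (hs n) hx']; ring
    have hu : ‖u x‖ ≤ ‖decayingPart s κ u q n‖ := by
      have h1 := norm_add_le (growingPart s κ u q n * Complex.exp (κ * (x - n)))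
        (decayingPart s κ u q n * Complex.exp (-(κ * (x - n))))
      rw [h2u, hg n, norm_mul, norm_mul, norm_mul, norm_mul, norm_exp_mul_sub,
        norm_exp_neg_mul_sub] at h1
      have h2 : Real.exp (-(κ.re * (x - n))) ≤ 1 := by
        apply Real.exp_le_one_iff.2; nlinarith
      have h3 : ‖r n‖ * Real.exp (κ.re * (x - n)) ≤ 1 := by
        calc _ ≤ W * Real.exp (2 * κ.re) := by
              refine mul_le_mul (hrW n) (Real.exp_le_exp.2 ?_) (Real.exp_pos _).le hW0.le
              nlinarith
          _ = 1 := hWinv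
      have h4 := mul_le_of_le_one_right (norm_nonneg (decayingPart s κ u q n)) h2
      have h5 := mul_le_of_le_one_right (norm_nonneg (decayingPart s κ u q n)) h3
      simp only [Complex.norm_ofNat] at h1
      nlinarith
    have hC0 : 0 ≤ C := by
      have := (sq_nonneg _).trans (hd 0)
      simpa using this
    calc ‖u x‖ ^ 2 ≤ ‖decayingPart s κ u q n‖ ^ 2 := by gcongr
      _ ≤ C * W ^ n := hd n
      _ ≤ _ := by
        gcongr
        rw [zpow_neg_one, hW, ← Real.exp_nat_mul, ← Real.exp_neg, ← Real.exp_add]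
        apply Real.exp_le_exp.2
        nlinarith
  have hcont : ContinuousOn u (Ici 0) := by
    intro x hx
    have hx : 0 ≤ x := hx
    have := (h.ac (x + 1) (by linarith)).continuousOn x (by
      rw [uIcc_of_le (by linarith)]; exact ⟨hx, by linarith⟩)
    rw [uIcc_of_le (by linarith)] at this
    refine this.mono_of_mem_nhdsWithin ?_
    rw [← Ici_inter_Iic]
    exact inter_mem self_mem_nhdsWithin (mem_nhdsWithin_of_mem_nhds (Iic_mem_nhds (by linarith)))
  have hmeas : AEStronglyMeasurable u (volume.restrict (Ioi (0 : ℝ))) :=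
    (hcont.mono Ioi_subset_Ici_self).aestronglyMeasurable measurableSet_Ioi
  have hL : MemLp u 2 (volume.restrict (Ioi (0 : ℝ))) := by
    rw [memLp_two_iff_integrable_sq_norm hmeas]
    have hint : IntegrableOn (fun x : ℝ => Real.exp (-(2 * κ.re) * x)) (Ioi 0) :=
      exp_neg_integrableOn_Ioi 0 (by linarith)
    refine ((hint.const_mul (W ^ (-1 : ℤ))).const_mul C).mono' (hmeas.norm.pow 2) ?_
    refine (ae_restrict_iff' measurableSet_Ioi).2 (ae_of_all _ fun x hx => ?_)
    rw [Real.norm_of_nonneg (by positivity)]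
    exact hbound x (le_of_lt hx)
  exact hL.of_measure_le_smul (ENNReal.natCast_ne_top M) (weightMeasure_le_smul_restrict hM)

/-- The Weyl–Titchmarsh function in terms of a Schur sequence with parameter `w = exp (-2κ)`. -/
theorem exists_weylM_eq (hκ : 0 < κ.re) (hs : ∀ n, 0 < s n) {M : ℕ} (hM : ∀ n, s n ≤ M) :
    ∃ r, IsSchurSequence (reflection s) (Complex.exp (-2 * κ)) r ∧
      weylM s (-κ ^ 2) = -(κ * s 0 * ((1 - r 0) / (1 + r 0))) := by
  have hκ0 : κ ≠ 0 := by rintro rfl; simp at hκ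
  have hs0 : (s 0 : ℂ) ≠ 0 := by exact_mod_cast (hs 0).ne'
  have hex : ∃ c, IsWeylCoefficient s (-κ ^ 2) c := by
    obtain ⟨r, hr⟩ := exists_isSchurSequence (ρ := reflection s) (w := Complex.exp (-2 * κ))
      (reflection_mem s hs) (norm_exp_neg_two_mul_lt_one hκ).le
    obtain ⟨θ, p, hθ, hθ0, hp0⟩ := exists_isSolution hs hκ0 1 0
    obtain ⟨φ, q, hφ, hφ0, hq0⟩ := exists_isSolution hs hκ0 0 1
    refine ⟨-(κ * s 0 * ((1 - r 0) / (1 + r 0))), θ, φ, ⟨p, hθ, hθ0, hp0⟩, ⟨q, hφ, hφ0, hq0⟩, ?_⟩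
    refine (hθ.add_const_mul hφ _).memLp_of_isSchurSequence hκ hs hM hr ?_
    have hr1 : 1 + r 0 ≠ 0 := by
      intro h0
      have h1 := (hr.norm_le (reflection_mem s hs) 0).trans_lt (norm_exp_neg_two_mul_lt_one hκ)
      rw [show r 0 = -1 by linear_combination h0] at h1
      simp at h1
    simp only [growingPart, decayingPart, Nat.cast_zero, hθ0, hp0, hφ0, hq0]
    field_simp
    ring
  obtain ⟨θ, φ, ⟨p, hθ, hθ0, hp0⟩, ⟨q, hφ, hφ0, hq0⟩, hL⟩ := Classical.epsilon_spec hex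
  have hsol := hθ.add_const_mul hφ (weylM s (-κ ^ 2))
  obtain ⟨r, hr, hq⟩ := hsol.exists_isSchurSequence hκ hs
    (hsol.flux_nonpos hκ hs hM hL) (by simp [hθ0, hφ0])
  exact ⟨r, hr, by simpa [hp0, hq0] using hq⟩

end Weyl

/-! ### Dependence of Schur sequences on their parameters -/

section SchurStability

variable {ρ ρ' : ℕ → ℝ} {w : ℂ} {r r' : ℕ → ℂ}

lemma half_le_norm_one_add_mul {a b : ℂ} (ha : ‖a‖ ≤ 1) (hb : ‖b‖ ≤ 1 / 2) :
    1 / 2 ≤ ‖1 + a * b‖ := by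
  have h1 : ‖a * b‖ ≤ 1 / 2 := by
    rw [norm_mul]
    exact (mul_le_of_le_one_left (norm_nonneg _) ha).trans hb
  have h2 := norm_sub_le_norm_add 1 (a * b)
  rw [norm_one] at h2
  linarith

lemma norm_one_add_mul_le_two {a b : ℂ} (ha : ‖a‖ ≤ 1) (hb : ‖b‖ ≤ 1) : ‖1 + a * b‖ ≤ 2 := by
  have h1 : ‖a * b‖ ≤ 1 := by
    rw [norm_mul]
    exact mul_le_one₀ ha (norm_nonneg _) hb
  have h2 := norm_add_le 1 (a * b)
  rw [norm_one] at h2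
  linarith

lemma norm_ofReal_le_one {a : ℝ} (ha : |a| < 1) : ‖(a : ℂ)‖ ≤ 1 := by
  simpa using ha.le

lemma one_sub_sq_mem {a : ℝ} (ha : |a| < 1) : 0 < 1 - a ^ 2 ∧ 1 - a ^ 2 ≤ 1 :=
  ⟨by have := (sq_lt_one_iff_abs_lt_one a).2 ha; linarith, by have := sq_nonneg a; linarith⟩

lemma norm_one_sub_sq {a : ℝ} (ha : |a| < 1) : ‖(1 : ℂ) - (a : ℂ) ^ 2‖ = 1 - a ^ 2 := by
  rw [show (1 : ℂ) - (a : ℂ) ^ 2 = ((1 - a ^ 2 : ℝ) : ℂ) by push_cast; ring, Complex.norm_real,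
    Real.norm_of_nonneg (one_sub_sq_mem ha).1.le]

lemma IsSchurSequence.sub_mul_eq (h : IsSchurSequence ρ w r) (h' : IsSchurSequence ρ' w r') {n : ℕ}
    (hn : ρ n = ρ' n) :
    (r n - r' n) * ((1 + ρ n * r (n + 1)) * (1 + ρ n * r' (n + 1))) =
      w * (1 - (ρ n : ℂ) ^ 2) * (r (n + 1) - r' (n + 1)) := by
  have h1 := h.step n
  have h2 := h'.step n
  rw [← hn] at h2
  linear_combination (1 + ρ n * r' (n + 1)) * h1 - (1 + ρ n * r (n + 1)) * h2

lemma IsSchurSequence.norm_sub_le (h : IsSchurSequence ρ w r) (h' : IsSchurSequence ρ' w r')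
    (hρ : ∀ n, |ρ n| < 1) (hρ' : ∀ n, |ρ' n| < 1) (hw : ‖w‖ ≤ 1 / 2) {k : ℕ}
    (hk : ∀ n < k, ρ n = ρ' n) : ‖r 0 - r' 0‖ ≤ (4 * ‖w‖) ^ k * ‖r k - r' k‖ := by
  induction k with
  | zero => simp
  | succ k ih =>
    refine (ih fun n hn => hk n (by omega)).trans ?_
    rw [pow_succ, mul_assoc]
    gcongr
    have e := congrArg norm (h.sub_mul_eq h' (hk k (by omega)))
    rw [norm_mul, norm_mul, norm_mul, norm_mul, norm_one_sub_sq (hρ k)] at e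
    have a1 := half_le_norm_one_add_mul (norm_ofReal_le_one (hρ k))
      ((h.norm_le hρ (k + 1)).trans hw)
    have a2 := half_le_norm_one_add_mul (norm_ofReal_le_one (hρ k))
      ((h'.norm_le hρ' (k + 1)).trans hw)
    have a3 : (1 / 2 * (1 / 2) : ℝ) ≤
        ‖1 + (ρ k : ℂ) * r (k + 1)‖ * ‖1 + (ρ k : ℂ) * r' (k + 1)‖ := by gcongr
    have a4 := mul_le_mul_of_nonneg_left a3 (norm_nonneg (r k - r' k))
    have a5 : ‖w‖ * (1 - ρ k ^ 2) ≤ ‖w‖ :=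
      mul_le_of_le_one_right (norm_nonneg _) (one_sub_sq_mem (hρ k)).2
    have a6 := mul_le_mul_of_nonneg_right a5 (norm_nonneg (r (k + 1) - r' (k + 1)))
    linarith

lemma IsSchurSequence.le_norm_sub (h : IsSchurSequence ρ w r) (h' : IsSchurSequence ρ' w r')
    (hρ : ∀ n, |ρ n| < 1) {k : ℕ} (hk : ∀ n < k, ρ n = ρ' n) :
    ‖w‖ ^ k * (∏ n ∈ Finset.range k, (1 - ρ n ^ 2) / 4) * ‖r k - r' k‖ ≤ ‖r 0 - r' 0‖ := by
  induction k with
  | zero => simp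
  | succ k ih =>
    refine le_trans ?_ (ih fun n hn => hk n (by omega))
    rw [pow_succ, Finset.prod_range_succ]
    have hP : 0 ≤ ‖w‖ ^ k * ∏ n ∈ Finset.range k, (1 - ρ n ^ 2) / 4 := by
      refine mul_nonneg (by positivity) (Finset.prod_nonneg fun n _ => ?_)
      have := (one_sub_sq_mem (hρ n)).1
      positivity
    have e := congrArg norm (h.sub_mul_eq h' (hk k (by omega)))
    rw [norm_mul, norm_mul, norm_mul, norm_mul, norm_one_sub_sq (hρ k)] at e
    have a1 := norm_one_add_mul_le_two (norm_ofReal_le_one (hρ k)) (h.norm_le_one (k + 1))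
    have a2 := norm_one_add_mul_le_two (norm_ofReal_le_one (hρ k)) (h'.norm_le_one (k + 1))
    have a3 : ‖1 + (ρ k : ℂ) * r (k + 1)‖ * ‖1 + (ρ k : ℂ) * r' (k + 1)‖ ≤ 2 * 2 := by gcongr
    have a4 := mul_le_mul_of_nonneg_left a3 (norm_nonneg (r k - r' k))
    have a5 : ‖w‖ * ((1 - ρ k ^ 2) / 4) * ‖r (k + 1) - r' (k + 1)‖ ≤ ‖r k - r' k‖ := by linarith
    calc _ = (‖w‖ ^ k * ∏ n ∈ Finset.range k, (1 - ρ n ^ 2) / 4) *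
          (‖w‖ * ((1 - ρ k ^ 2) / 4) * ‖r (k + 1) - r' (k + 1)‖) := by ring
      _ ≤ _ := mul_le_mul_of_nonneg_left a5 hP

lemma IsSchurSequence.norm_sub_mul_le (h : IsSchurSequence ρ w r) (hρ : ∀ n, |ρ n| < 1)
    (hw : ‖w‖ ≤ 1 / 2) (n : ℕ) : ‖r n - w * ρ n‖ ≤ 2 * ‖w‖ ^ 2 := by
  have e : (r n - w * ρ n) * (1 + ρ n * r (n + 1)) = w * r (n + 1) * (1 - (ρ n : ℂ) ^ 2) := by
    linear_combination h.step n
  have e := congrArg norm e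
  rw [norm_mul, norm_mul, norm_mul, norm_one_sub_sq (hρ n)] at e
  have hr := h.norm_le hρ (n + 1)
  have a1 := half_le_norm_one_add_mul (norm_ofReal_le_one (hρ n)) (hr.trans hw)
  have a2 := mul_le_mul_of_nonneg_left a1 (norm_nonneg (r n - w * ρ n))
  have a3 : ‖w‖ * ‖r (n + 1)‖ * (1 - ρ n ^ 2) ≤ ‖w‖ * ‖w‖ :=
    (mul_le_of_le_one_right (by positivity) (one_sub_sq_mem (hρ n)).2).trans (by gcongr)
  nlinarith

lemma IsSchurSequence.le_norm_sub_of_ne (h : IsSchurSequence ρ w r) (h' : IsSchurSequence ρ' w r')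
    (hρ : ∀ n, |ρ n| < 1) (hρ' : ∀ n, |ρ' n| < 1) (hw : ‖w‖ ≤ 1 / 2) (n : ℕ) :
    ‖w‖ * (|ρ n - ρ' n| - 4 * ‖w‖) ≤ ‖r n - r' n‖ := by
  have h1 := h.norm_sub_mul_le hρ hw n
  have h2 := h'.norm_sub_mul_le hρ' hw n
  have h3 : ‖w * ((ρ n : ℂ) - ρ' n)‖ = ‖w‖ * |ρ n - ρ' n| := by
    rw [norm_mul, ← Complex.ofReal_sub, Complex.norm_real, Real.norm_eq_abs]
  have h4 : w * ((ρ n : ℂ) - ρ' n) = (r n - r' n) - (r n - w * ρ n) + (r' n - w * ρ' n) := by ring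
  have h5 : ‖w * ((ρ n : ℂ) - ρ' n)‖ ≤ ‖r n - r' n‖ + ‖r n - w * ρ n‖ + ‖r' n - w * ρ' n‖ := by
    rw [h4]
    exact (norm_add_le _ _).trans (by gcongr; exact _root_.norm_sub_le _ _)
  rw [h3] at h5
  nlinarith

end SchurStability

/-! ### Two-sided bounds for differences of Weyl–Titchmarsh functions -/

lemma one_add_ne_zero_of_norm {a : ℂ} (ha : ‖a‖ ≤ 1 / 2) : 1 + a ≠ 0 := by
  intro h
  have : a = -1 := by linear_combination h
  rw [this] at ha
  norm_num at ha

/-- The Cayley transform `(1 - a) / (1 + a)` is bi-Lipschitz near the origin. -/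
lemma norm_cayley_sub {a b : ℂ} (ha : ‖a‖ ≤ 1 / 2) (hb : ‖b‖ ≤ 1 / 2) :
    ‖a - b‖ / 2 ≤ ‖(1 - a) / (1 + a) - (1 - b) / (1 + b)‖ ∧
      ‖(1 - a) / (1 + a) - (1 - b) / (1 + b)‖ ≤ 8 * ‖a - b‖ := by
  have ha0 := one_add_ne_zero_of_norm ha
  have hb0 := one_add_ne_zero_of_norm hb
  have e : (1 - a) / (1 + a) - (1 - b) / (1 + b) = 2 * (b - a) / ((1 + a) * (1 + b)) := by
    field_simp
    ring
  have a1 := half_le_norm_one_add_mul (a := 1) (by simp) ha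
  have a2 := half_le_norm_one_add_mul (a := 1) (by simp) hb
  have b1 := norm_one_add_mul_le_two (a := 1) (by simp) (ha.trans (by norm_num))
  have b2 := norm_one_add_mul_le_two (a := 1) (by simp) (hb.trans (by norm_num))
  rw [one_mul] at a1 a2 b1 b2
  rw [e, norm_div, norm_mul, norm_mul, norm_sub_rev b a, Complex.norm_ofNat]
  have hpos : 0 < ‖1 + a‖ * ‖1 + b‖ := by positivity
  have c1 : (1 / 2 * (1 / 2) : ℝ) ≤ ‖1 + a‖ * ‖1 + b‖ := by gcongr
  have c2 : ‖1 + a‖ * ‖1 + b‖ ≤ 2 * 2 := by gcongr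
  constructor
  · rw [le_div_iff₀ hpos]
    nlinarith [norm_nonneg (a - b)]
  · rw [div_le_iff₀ hpos]
    nlinarith [norm_nonneg (a - b)]

lemma norm_cayley_sub_one {a : ℂ} (ha : ‖a‖ ≤ 1 / 2) : ‖(1 - a) / (1 + a) - 1‖ ≤ 8 * ‖a‖ := by
  simpa using (norm_cayley_sub ha (b := 0) (by simp)).2

section Weyl

variable {s t : ℕ → ℕ}

lemma norm_weylM_sub_le (hs : ∀ n, 0 < s n) (ht : ∀ n, 0 < t n) {M : ℕ} (hsM : ∀ n, s n ≤ M)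
    (htM : ∀ n, t n ≤ M) {k : ℕ} (hst : ∀ j ≤ k, s j = t j) {κ : ℂ} (hκ : 0 < κ.re)
    (hw : Real.exp (-(2 * κ.re)) ≤ 1 / 2) :
    ‖weylM s (-κ ^ 2) - weylM t (-κ ^ 2)‖ ≤
      16 * 4 ^ k * s 0 * (‖κ‖ * Real.exp (-(2 * κ.re)) ^ (k + 1)) := by
  obtain ⟨r, hr, hm⟩ := exists_weylM_eq hκ hs hsM
  obtain ⟨r', hr', hm'⟩ := exists_weylM_eq hκ ht htM
  rw [← norm_exp_neg_two_mul] at hw ⊢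
  set w := Complex.exp (-2 * κ)
  have h1 := hr.norm_sub_le hr' (reflection_mem s hs) (reflection_mem t ht) hw (k := k)
    fun n hn => by rw [reflection, reflection, hst n hn.le, hst (n + 1) hn]
  have b := fun n => hr.norm_le (reflection_mem s hs) n
  have b' := fun n => hr'.norm_le (reflection_mem t ht) n
  have h2 : ‖r k - r' k‖ ≤ 2 * ‖w‖ :=
    (norm_sub_le _ _).trans (by linarith [b k, b' k])
  have h3 := (norm_cayley_sub ((b 0).trans hw) ((b' 0).trans hw)).2
  rw [hm, hm', ← hst 0 (Nat.zero_le _)]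
  calc _ = ‖κ‖ * s 0 * ‖(1 - r 0) / (1 + r 0) - (1 - r' 0) / (1 + r' 0)‖ := by
        rw [← norm_neg]
        rw [show -(-(κ * s 0 * ((1 - r 0) / (1 + r 0))) - -(κ * s 0 * ((1 - r' 0) / (1 + r' 0)))) =
          κ * s 0 * ((1 - r 0) / (1 + r 0) - (1 - r' 0) / (1 + r' 0)) by ring]
        rw [norm_mul, norm_mul, Complex.norm_natCast]
    _ ≤ ‖κ‖ * s 0 * (8 * ((4 * ‖w‖) ^ k * (2 * ‖w‖))) := by
        gcongr
        refine h3.trans ?_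
        gcongr
        exact h1.trans (by gcongr)
    _ = _ := by rw [mul_pow]; ring

lemma reflection_ne (hs : ∀ n, 0 < s n) (ht : ∀ n, 0 < t n) {i : ℕ} (h1 : s i = t i)
    (h2 : s (i + 1) ≠ t (i + 1)) : reflection s i ≠ reflection t i := by
  intro h
  have p0 : (0 : ℝ) < t i := by exact_mod_cast ht i
  have p1 : (0 : ℝ) < s (i + 1) := by exact_mod_cast hs (i + 1)
  have p2 : (0 : ℝ) < t (i + 1) := by exact_mod_cast ht (i + 1)
  rw [reflection, reflection, h1, div_eq_div_iff (by positivity) (by positivity)] at h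
  have h3 : (t i : ℝ) * (s (i + 1)) = t i * t (i + 1) := by linarith
  exact h2 (by exact_mod_cast mul_left_cancel₀ p0.ne' h3)

/-- If the sequences first differ at `j ≤ k`, the difference of the Weyl–Titchmarsh functions is at
least of order `|κ| |w|ʲ`, `w = exp (-2κ)`. -/
lemma exists_le_norm_weylM_sub (hs : ∀ n, 0 < s n) (ht : ∀ n, 0 < t n) {M : ℕ}
    (hsM : ∀ n, s n ≤ M) (htM : ∀ n, t n ≤ M) {k : ℕ} (hst : ∃ j ≤ k, s j ≠ t j) :
    ∃ c > 0, ∃ δ > 0, ∀ κ : ℂ, 0 < κ.re → Real.exp (-(2 * κ.re)) ≤ δ →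
      c * (‖κ‖ * Real.exp (-(2 * κ.re)) ^ k) ≤ ‖weylM s (-κ ^ 2) - weylM t (-κ ^ 2)‖ := by
  classical
  have hex : ∃ j, s j ≠ t j := let ⟨j, _, h⟩ := hst; ⟨j, h⟩
  have hne := Nat.find_spec hex
  have hmin := fun m => @Nat.find_min _ _ hex m
  have hjk : Nat.find hex ≤ k := let ⟨j, hj, h⟩ := hst; (Nat.find_min' hex h).trans hj
  have hs0 : (0 : ℝ) < s 0 := by exact_mod_cast hs 0
  have ht0 : (0 : ℝ) < t 0 := by exact_mod_cast ht 0
  revert hne hmin hjk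
  generalize Nat.find hex = j
  intro hne hmin hjk
  suffices H : ∃ c > 0, ∃ δ > 0, δ ≤ 1 / 2 ∧ ∀ κ : ℂ, 0 < κ.re → ∀ r r' : ℕ → ℂ,
      IsSchurSequence (reflection s) (Complex.exp (-2 * κ)) r →
      IsSchurSequence (reflection t) (Complex.exp (-2 * κ)) r' →
      ‖Complex.exp (-2 * κ)‖ ≤ δ →
      c * (‖κ‖ * ‖Complex.exp (-2 * κ)‖ ^ j) ≤
        ‖κ * s 0 * ((1 - r 0) / (1 + r 0)) - κ * t 0 * ((1 - r' 0) / (1 + r' 0))‖ by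
    obtain ⟨c, hc, δ, hδ, hδ2, H⟩ := H
    refine ⟨c, hc, δ, hδ, fun κ hκ hw => ?_⟩
    obtain ⟨r, hr, hm⟩ := exists_weylM_eq hκ hs hsM
    obtain ⟨r', hr', hm'⟩ := exists_weylM_eq hκ ht htM
    rw [← norm_exp_neg_two_mul] at hw ⊢
    have h1 := H κ hκ r r' hr hr' hw
    rw [hm, hm', neg_sub_neg, norm_sub_rev]
    refine le_trans ?_ h1
    gcongr 1
    gcongr 1
    exact pow_le_pow_of_le_one (norm_nonneg _) (norm_exp_neg_two_mul_lt_one hκ).le hjk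
  rcases j with _ | i
  · set D := |(s 0 : ℝ) - t 0| with hD
    have hD0 : 0 < D := abs_pos.2 (sub_ne_zero.2 (by exact_mod_cast hne))
    refine ⟨D / 2, by positivity, min (1 / 2) (D / (16 * (s 0 + t 0))), by positivity,
      min_le_left _ _, fun κ hκ r r' hr hr' hw => ?_⟩
    set w := Complex.exp (-2 * κ)
    have hw1 := hw.trans (min_le_left _ _)
    have hw2 := hw.trans (min_le_right _ _)
    rw [le_div_iff₀ (by positivity)] at hw2
    have b := hr.norm_le (reflection_mem s hs) 0
    have b' := hr'.norm_le (reflection_mem t ht) 0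
    have c1 := norm_cayley_sub_one (b.trans hw1)
    have c2 := norm_cayley_sub_one (b'.trans hw1)
    set A := (1 - r 0) / (1 + r 0)
    set B := (1 - r' 0) / (1 + r' 0)
    have e : κ * s 0 * A - κ * t 0 * B = κ * (s 0 * A - t 0 * B) := by ring
    have e2 : ((s 0 : ℂ) - t 0) = (s 0 * A - t 0 * B) - s 0 * (A - 1) + t 0 * (B - 1) := by ring
    have e3 : ‖(s 0 : ℂ) - t 0‖ = D := by
      rw [hD, ← Real.norm_eq_abs, ← Complex.norm_real]; push_cast; rfl
    have e4 : D ≤ ‖s 0 * A - t 0 * B‖ + s 0 * ‖A - 1‖ + t 0 * ‖B - 1‖ := by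
      rw [← e3, e2, ← Complex.norm_natCast (s 0), ← Complex.norm_natCast (t 0), ← norm_mul,
        ← norm_mul]
      exact (norm_add_le _ _).trans (by gcongr; exact norm_sub_le _ _)
    have e5 : s 0 * ‖A - 1‖ ≤ s 0 * (8 * ‖w‖) := by gcongr; linarith
    have e6 : t 0 * ‖B - 1‖ ≤ t 0 * (8 * ‖w‖) := by gcongr; linarith
    rw [e, norm_mul, pow_zero, mul_one, mul_comm (D / 2)]
    gcongr
    linarith
  · have hlt : ∀ n ≤ i, s n = t n := fun n hn => not_not.1 (hmin n (by omega))
    set D := |reflection s i - reflection t i| with hD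
    have hD0 : 0 < D := abs_pos.2 (sub_ne_zero.2 (reflection_ne hs ht (hlt i le_rfl) hne))
    set P := ∏ n ∈ Finset.range i, (1 - reflection s n ^ 2) / 4 with hP
    have hP0 : 0 < P := Finset.prod_pos fun n _ => by
      have := (one_sub_sq_mem (reflection_mem s hs n)).1
      positivity
    refine ⟨s 0 * P * D / 4, by positivity, min (1 / 2) (D / 8), by positivity,
      min_le_left _ _, fun κ hκ r r' hr hr' hw => ?_⟩
    set w := Complex.exp (-2 * κ)
    have hw1 := hw.trans (min_le_left _ _)
    have hw2 := hw.trans (min_le_right _ _)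
    have b := hr.norm_le (reflection_mem s hs) 0
    have b' := hr'.norm_le (reflection_mem t ht) 0
    have c1 := (norm_cayley_sub (b.trans hw1) (b'.trans hw1)).1
    have c2 := hr.le_norm_sub hr' (reflection_mem s hs) (k := i)
      fun n hn => by rw [reflection, reflection, hlt n hn.le, hlt (n + 1) hn]
    have c3 := hr.le_norm_sub_of_ne hr' (reflection_mem s hs) (reflection_mem t ht) hw1 i
    have c4 : ‖w‖ * (D / 2) ≤ ‖r i - r' i‖ := le_trans (by gcongr; linarith) c3
    rw [← hlt 0 (Nat.zero_le _), ← mul_sub, norm_mul, norm_mul, Complex.norm_natCast]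
    calc _ = ‖κ‖ * s 0 * ((‖w‖ ^ i * P * (‖w‖ * (D / 2))) / 2) := by rw [pow_succ]; ring
      _ ≤ _ := by
        gcongr
        refine le_trans ?_ c1
        gcongr
        exact le_trans (by gcongr) c2

end Weyl

/-- Along a ray off the positive half-line, `√(-z)` is `√|z|` times a fixed number in the right
half-plane. -/
lemma exists_sqrt_ray {α : ℝ} (hα : α ∈ Ioo (-Real.pi) Real.pi) (hα0 : α ≠ 0) :
    ∃ κ₀ : ℂ, 0 < κ₀.re ∧ ‖κ₀‖ = 1 ∧ ∀ r : ℝ, 0 < r →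
      (-((r : ℂ) * Complex.exp ((α : ℂ) * Complex.I))) ^ (1 / 2 : ℂ) = (Real.sqrt r : ℂ) * κ₀ ∧
      (r : ℂ) * Complex.exp ((α : ℂ) * Complex.I) = -((Real.sqrt r : ℂ) * κ₀) ^ 2 := by
  set ζ := -Complex.exp ((α : ℂ) * Complex.I) with hζ
  have hζ0 : ζ ≠ 0 := neg_ne_zero.2 (Complex.exp_ne_zero _)
  have hζn : ‖ζ‖ = 1 := by rw [hζ, norm_neg, Complex.norm_exp_ofReal_mul_I]
  have him : ζ.im ≠ 0 := by
    rw [hζ, Complex.neg_im, Complex.exp_ofReal_mul_I_im, neg_ne_zero]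
    intro h
    rw [Real.sin_eq_zero_iff_of_lt_of_lt hα.1 hα.2] at h
    exact hα0 h
  have hsq : (ζ ^ (1 / 2 : ℂ)) ^ 2 = ζ := by
    rw [one_div]; exact_mod_cast Complex.cpow_nat_inv_pow ζ two_ne_zero
  refine ⟨ζ ^ (1 / 2 : ℂ), ?_, ?_, fun r hr => ?_⟩
  · rw [Complex.cpow_def_of_ne_zero hζ0, Complex.exp_re]
    refine mul_pos (Real.exp_pos _) (Real.cos_pos_of_mem_Ioo ?_)
    have e : (Complex.log ζ * (1 / 2)).im = ζ.arg / 2 := by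
      rw [show Complex.log ζ * (1 / 2) = ((1 / 2 : ℝ) : ℂ) * Complex.log ζ by push_cast; ring,
        Complex.im_ofReal_mul, Complex.log_im]
      ring
    rw [e]
    have h1 := Complex.neg_pi_lt_arg ζ
    have h2 : ζ.arg < Real.pi := lt_of_le_of_ne (Complex.arg_le_pi ζ)
      fun h => him (Complex.arg_eq_pi_iff.1 h).2
    constructor <;> linarith
  · have := congrArg norm hsq
    rw [norm_pow, hζn] at this
    exact (pow_eq_one_iff_of_nonneg (norm_nonneg _) two_ne_zero).1 this
  · have e : -((r : ℂ) * Complex.exp ((α : ℂ) * Complex.I)) = (r : ℂ) * ζ := by rw [hζ]; ring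
    have hr0 : (r : ℂ) ≠ 0 := by exact_mod_cast hr.ne'
    constructor
    · rw [e, Complex.cpow_def_of_ne_zero (mul_ne_zero hr0 hζ0), Complex.cpow_def_of_ne_zero hζ0,
        Complex.log_ofReal_mul hr hζ0, add_mul, Complex.exp_add]
      congr 1
      rw [Real.sqrt_eq_rpow, Real.rpow_def_of_pos hr]
      push_cast
      rfl
    · rw [mul_pow, hsq, ← Complex.ofReal_pow, Real.sq_sqrt hr.le, ← e, neg_neg]

end ImpedanceSL

end

theorem theorem3p2 (J : Finset ℕ) (hJ : ∀ j ∈ J, 0 < j) (s t : ℕ → ℕ)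
    (hs : ∀ n, s n ∈ J) (ht : ∀ n, t n ∈ J) (k : ℕ) :
    (∀ j : ℕ, j ≤ k → s j = t j) ↔
      ∀ α : ℝ, α ∈ Set.Ioo (-Real.pi) Real.pi → α ≠ 0 →
        (fun r : ℝ =>
            ‖ImpedanceSL.weylM s ((r : ℂ) * Complex.exp ((α : ℂ) * Complex.I)) -
              ImpedanceSL.weylM t ((r : ℂ) * Complex.exp ((α : ℂ) * Complex.I))‖)
          =o[Filter.atTop]
        (fun r : ℝ =>
            Real.exp (-2 * ((k : ℝ) + 1 / 2) *
              ((-((r : ℂ) * Complex.exp ((α : ℂ) * Complex.I))) ^ (1 / 2 : ℂ)).re)) := by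
  have hs0 : ∀ n, 0 < s n := fun n => hJ _ (hs n)
  have ht0 : ∀ n, 0 < t n := fun n => hJ _ (ht n)
  have hsM : ∀ n, s n ≤ J.sup id := fun n => Finset.le_sup (f := id) (hs n)
  have htM : ∀ n, t n ≤ J.sup id := fun n => Finset.le_sup (f := id) (ht n)
  have hre : ∀ (r : ℝ) (κ₀ : ℂ), ((Real.sqrt r : ℂ) * κ₀).re = Real.sqrt r * κ₀.re :=
    fun r κ₀ => Complex.re_ofReal_mul _ _
  have hnorm : ∀ (r : ℝ) (κ₀ : ℂ), ‖κ₀‖ = 1 → ‖(Real.sqrt r : ℂ) * κ₀‖ = Real.sqrt r :=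
    fun r κ₀ h => by
      rw [norm_mul, h, mul_one, Complex.norm_real, Real.norm_of_nonneg (Real.sqrt_nonneg _)]
  have hlim : ∀ a : ℝ, 0 < a → Tendsto (fun r : ℝ => Real.sqrt r * a) atTop atTop :=
    fun a ha => Real.tendsto_sqrt_atTop.atTop_mul_const ha
  have hsmall : ∀ a : ℝ, 0 < a → ∀ δ : ℝ, 0 < δ →
      ∀ᶠ r : ℝ in atTop, Real.exp (-(2 * (Real.sqrt r * a))) ≤ δ := by
    intro a ha δ hδ
    have : Tendsto (fun r : ℝ => Real.exp (-(2 * (Real.sqrt r * a)))) atTop (nhds 0) :=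
      Real.tendsto_exp_neg_atTop_nhds_zero.comp ((hlim a ha).const_mul_atTop two_pos)
    exact this.eventually_le_const hδ
  constructor
  · intro hst α hα hα0
    obtain ⟨κ₀, hκ₀, hκ₀n, hκ⟩ := ImpedanceSL.exists_sqrt_ray hα hα0
    have hO : (fun r : ℝ =>
        ‖ImpedanceSL.weylM s ((r : ℂ) * Complex.exp ((α : ℂ) * Complex.I)) -
          ImpedanceSL.weylM t ((r : ℂ) * Complex.exp ((α : ℂ) * Complex.I))‖) =O[atTop]
        fun r : ℝ => ((Real.sqrt r * κ₀.re) ^ 1 * Real.exp (-(Real.sqrt r * κ₀.re))) *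
          Real.exp (-2 * ((k : ℝ) + 1 / 2) *
              ((-((r : ℂ) * Complex.exp ((α : ℂ) * Complex.I))) ^ (1 / 2 : ℂ)).re) := by
      refine IsBigO.of_bound (16 * 4 ^ k * s 0 / κ₀.re) ?_
      filter_upwards [hsmall κ₀.re hκ₀ (1 / 2) (by norm_num), eventually_gt_atTop 0] with r hw hr
      obtain ⟨h1, h2⟩ := hκ r hr
      have hsr : 0 < Real.sqrt r := Real.sqrt_pos.2 hr
      have hb := ImpedanceSL.norm_weylM_sub_le hs0 ht0 hsM htM hst
        (κ := (Real.sqrt r : ℂ) * κ₀) (by rw [hre]; positivity) (by rw [hre]; exact hw)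
      rw [h1, h2, norm_norm, hre]
      refine hb.trans (le_of_eq ?_)
      rw [hre, hnorm r κ₀ hκ₀n, Real.norm_of_nonneg (by positivity), ← Real.exp_nat_mul,
        mul_assoc ((Real.sqrt r * κ₀.re) ^ 1), ← Real.exp_add]
      rw [show -(Real.sqrt r * κ₀.re) + -2 * ((k : ℝ) + 1 / 2) * (Real.sqrt r * κ₀.re) =
        ((k + 1 : ℕ) : ℝ) * -(2 * (Real.sqrt r * κ₀.re)) by push_cast; ring]
      field_simp
    refine hO.trans_isLittleO ?_
    have h0 : (fun r : ℝ => (Real.sqrt r * κ₀.re) ^ 1 * Real.exp (-(Real.sqrt r * κ₀.re)))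
        =o[atTop] fun _ => (1 : ℝ) :=
      (isLittleO_one_iff ℝ).2
        ((Real.tendsto_pow_mul_exp_neg_atTop_nhds_zero 1).comp (hlim κ₀.re hκ₀))
    simpa using h0.mul_isBigO (isBigO_refl (fun r : ℝ => Real.exp (-2 * ((k : ℝ) + 1 / 2) *
      ((-((r : ℂ) * Complex.exp ((α : ℂ) * Complex.I))) ^ (1 / 2 : ℂ)).re)) atTop)
  · intro h
    by_contra! hst
    have hα : Real.pi / 2 ∈ Set.Ioo (-Real.pi) Real.pi := by
      constructor <;> linarith [Real.pi_pos]
    have hα0 : Real.pi / 2 ≠ 0 := by positivity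
    obtain ⟨κ₀, hκ₀, hκ₀n, hκ⟩ := ImpedanceSL.exists_sqrt_ray hα hα0
    obtain ⟨c, hc, δ, hδ, hlow⟩ := ImpedanceSL.exists_le_norm_weylM_sub hs0 ht0 hsM htM hst
    have hev := (isLittleO_iff.1 (h _ hα hα0)) hc
    have hfalse : ∀ᶠ r : ℝ in atTop, False := by
      filter_upwards [hev, hsmall κ₀.re hκ₀ δ hδ, eventually_gt_atTop 1] with r h3 hw hr1
      have hr : 0 < r := by linarith
      obtain ⟨h1, h2⟩ := hκ r hr
      have hsr : 1 < Real.sqrt r := Real.lt_sqrt_of_sq_lt (by linarith)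
      have h4 := hlow ((Real.sqrt r : ℂ) * κ₀) (by rw [hre]; positivity) (by rw [hre]; exact hw)
      rw [h1, h2, norm_norm, hre, Real.norm_of_nonneg (Real.exp_pos _).le] at h3
      rw [hre, hnorm r κ₀ hκ₀n, ← Real.exp_nat_mul] at h4
      have h5 : Real.exp (-2 * ((k : ℝ) + 1 / 2) * (Real.sqrt r * κ₀.re)) ≤
          Real.exp ((k : ℝ) * -(2 * (Real.sqrt r * κ₀.re))) := by
        apply Real.exp_le_exp.2
        have : 0 < Real.sqrt r * κ₀.re := by positivity
        linarith
      have h6 : c * (Real.sqrt r * Real.exp ((k : ℝ) * -(2 * (Real.sqrt r * κ₀.re)))) ≤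
          c * Real.exp ((k : ℝ) * -(2 * (Real.sqrt r * κ₀.re))) :=
        (h4.trans h3).trans (by gcongr)
      have h7 := le_of_mul_le_mul_left h6 hc
      have h8 := lt_mul_of_one_lt_left
        (Real.exp_pos ((k : ℝ) * -(2 * (Real.sqrt r * κ₀.re)))) hsr
      linarith
    exact hfalse.exists.elim fun _ hf => hf
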